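/- **Theorem.** Let $K$ be a field, let $n,k$ be integers with $1<k<n$, and let $V$ be a $2n$-dimensional $K$-vector space with a non-degenerate alternating bilinear form $f$. Let $\mathcal S=\mathrm W(2n-1,K)$ be the symplectic polar space of $f$, whose singular subspaces are the totally $f$-isotropic subspaces of $V$. Let $\mathcal S_k$ be its $k$-grassmannian. The points of $\mathcal S_k$ are the totally isotropic $k$-dimensional subspaces of $V$. Its lines are the sets $\{X : \dim X=k,\ Z_1\subset X\subset Z_2\}$, where $Z_1\subset Z_2$ are totally isotropic subspaces of dimensions $k-1$ and $k+1$. Let $\varepsilon$ be the Plücker embedding of $\mathcal S_k$, $\langle v_1,\dots,v_k\rangle\mapsto\langle v_1\wedge\cdots\wedge v_k\rangle$. Its codomain is the projective subspace $\Sigma$ of $\mathrm{PG}(\bigwedge^kV)$ spanned by the image $|\varepsilon|$ of $\varepsilon$. Let $\mathrm{aut}(|\varepsilon|)$ be the set-wise stabilizer of $|\varepsilon|$ in the group of collineations of $\Sigma$. Let $\mathrm{Aut}(\varepsilon)$ be the subgroup of those elements of $\mathrm{aut}(|\varepsilon|)$ that also stabilize the set $\{\varepsilon(\ell) : \ell \text{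 a line of } \mathcal S_k\}$. Then $$\mathrm{aut}(|\varepsilon|)=\mathrm{Aut}(\varepsilon).$$ Moreover $\varepsilon$ is not transparent: some line of $\Sigma$ contained in $|\varepsilon|$ is not of the form $\varepsilon(\ell)$ with $\ell$ a line of $\mathcal S_k$. -/

import Mathlib

open scoped LinearAlgebra.Projectivization Pointwise

noncomputable section

namespace SymplecticGrassmann

/-! ### Projective spaces and maps into them -/

section Projective

variable (K : Type*) [Field K] (E : Type*) [AddCommGroup E] [Module K E]

/-- The set of lines of `PG(E)`, each line being regarded as a set of points. -/
def projLines : Set (Set (ℙ K E)) :=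
  {S | ∃ U : Submodule K E, Module.finrank K U = 2 ∧ S = {p | p.submodule ≤ U}}

/-- The group of collineations of `PG(E)`: the permutations of the point-set that map the set of
lines onto itself. -/
def collineationGroup : Subgroup (Equiv.Perm (ℙ K E)) :=
  MulAction.stabilizer (Equiv.Perm (ℙ K E)) (projLines K E)

theorem mem_collineationGroup_iff (g : Equiv.Perm (ℙ K E)) :
    g ∈ collineationGroup K E ↔ ∀ S : Set (ℙ K E), g '' S ∈ projLines K E ↔ S ∈ projLines K E := by
  have key : ∀ S : Set (ℙ K E), g • S = g '' S := fun S => rfl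
  rw [collineationGroup, MulAction.mem_stabilizer_iff]
  constructor
  · intro h S
    rw [← key]
    conv_lhs => rw [← h]
    exact Set.smul_mem_smul_set_iff
  · intro h
    ext S
    rw [Set.mem_smul_set_iff_inv_smul_mem, ← h (g⁻¹ • S), ← key, smul_inv_smul]

variable {K E}

/-- The support `|ε|` of a map `ε` into a projective space: its image. -/
def support {P : Type*} (ε : P → ℙ K E) : Set (ℙ K E) := Set.range ε

/-- The `ε`-images of the lines of a point-line geometry with point-set `P` and line-set `L`. -/
def imageLines {P : Type*} (ε : P → ℙ K E) (L : Set (Set P)) : Set (Set (ℙ K E)) :=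
  (fun l : Set P => ε '' l) '' L

/-- `aut(|ε|)`: the set-wise stabilizer of the support of `ε` in the collineation group. -/
def autSupport {P : Type*} (ε : P → ℙ K E) : Subgroup (collineationGroup K E) :=
  MulAction.stabilizer (collineationGroup K E) (support ε)

/-- `Aut(ε)`: the set-wise stabilizer in `aut(|ε|)` of the set of `ε`-images of lines. -/
def autEmbedding {P : Type*} (ε : P → ℙ K E) (L : Set (Set P)) :
    Subgroup (collineationGroup K E) :=
  autSupport ε ⊓ MulAction.stabilizer (collineationGroup K E) (imageLines ε L)

/-- `ε` is transparent: all projective lines contained in the support are images of lines. -/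
def IsTransparent {P : Type*} (ε : P → ℙ K E) (L : Set (Set P)) : Prop :=
  ∀ S ∈ projLines K E, S ⊆ support ε → S ∈ imageLines ε L

/-- The vector subspace of `E` corresponding to the projective span of the image of `φ`. -/
def imageSpan {P : Type*} (φ : P → ℙ K E) : Submodule K E := ⨆ p, (φ p).submodule

/-- The map `φ`, with the projective span of its image as codomain. -/
def toImageSpan {P : Type*} (φ : P → ℙ K E) (p : P) : ℙ K (imageSpan φ) :=
  Projectivization.mk K
    (⟨(φ p).rep, le_iSup (fun q => (φ q).submodule) p (by
      rw [Projectivization.submodule_eq]; exact Submodule.mem_span_singleton_self _)⟩ :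
        imageSpan φ)
    (fun h => (φ p).rep_nonzero (congrArg Subtype.val h))

theorem map_toImageSpan {P : Type*} (φ : P → ℙ K E) (p : P) :
    Projectivization.map (imageSpan φ).subtype (imageSpan φ).injective_subtype (toImageSpan φ p)
      = φ p := by
  simp only [toImageSpan, Projectivization.map_mk, Submodule.subtype_apply]
  exact Projectivization.mk_rep _

end Projective

/-! ### The Plücker map -/

section Pluecker

variable {K : Type*} [Field K] {V : Type*} [AddCommGroup V] [Module K V]

theorem wedge_ne_zero {k : ℕ} {v : Fin k → V} (hv : LinearIndependent K v) :
    exteriorPower.ιMulti K k v ≠ 0 := by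
  classical
  obtain ⟨g, hg⟩ := (Fintype.linearCombination K v).exists_leftInverse_of_injective
    (LinearMap.ker_eq_bot.2 hv.fintypeLinearCombination_injective)
  have hgv : ∀ i, g (v i) = Pi.single i 1 := fun i => by
    have := LinearMap.congr_fun hg (Pi.single i 1)
    simpa [Fintype.linearCombination_apply_single] using this
  intro h0
  have h1 := exteriorPower.alternatingMapLinearEquiv_apply_ιMulti
    ((Matrix.detRowAlternating (R := K) (n := Fin k)).compLinearMap g) v
  rw [h0, map_zero] at h1
  have h2 : (fun i => g (v i)) = (1 : Matrix (Fin k) (Fin k) K) := by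
    ext i j
    rw [hgv i, Matrix.one_apply, Pi.single_apply]
    simp [eq_comm]
  have h3 : ((Matrix.detRowAlternating (R := K) (n := Fin k)).compLinearMap g) v = 1 := by
    change Matrix.det (fun i => g (v i)) = 1
    rw [h2, Matrix.det_one]
  rw [h3] at h1
  exact zero_ne_one h1

/-- The Plücker map on the subspaces of `V` of dimension `k`: it sends `⟨v₁, …, vₖ⟩` to the point
`⟨v₁ ∧ ⋯ ∧ vₖ⟩` of `PG(⋀ᵏ V)` (see `pluecker_eq` for the independence of the basis). -/
def pluecker {k : ℕ} (hk : 0 < k) (X : Submodule K V) (hX : Module.finrank K X = k) :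
    ℙ K (⋀[K]^k V) :=
  haveI : Module.Finite K X := Module.finite_of_finrank_pos (hX ▸ hk)
  Projectivization.mk K
    (exteriorPower.ιMulti K k fun i => (Module.finBasisOfFinrankEq K X hX i : V))
    (wedge_ne_zero ((Module.finBasisOfFinrankEq K X hX).linearIndependent.map' X.subtype
      X.ker_subtype))

theorem pluecker_eq {k : ℕ} (hk : 0 < k) (X : Submodule K V) (hX : Module.finrank K X = k)
    (v : Fin k → V) (hv : LinearIndependent K v) (hspan : Submodule.span K (Set.range v) = X) :
    pluecker hk X hX = Projectivization.mk K (exteriorPower.ιMulti K k v) (wedge_ne_zero hv) := by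
  classical
  subst hspan
  have : Module.Finite K (Submodule.span K (Set.range v)) :=
    Module.finite_of_finrank_pos (by omega)
  let e := Module.Basis.span hv
  let f := (exteriorPower.ιMulti K k (M := V)).compLinearMap
    (Submodule.span K (Set.range v)).subtype
  have hf : f = (LinearMap.toSpanSingleton K _ (f e)).compAlternatingMap e.det := by
    refine Module.Basis.ext_alternating e fun w hw => ?_
    obtain ⟨σ, rfl⟩ : ∃ σ : Equiv.Perm (Fin k), w = σ :=
      ⟨Equiv.ofBijective w (Finite.injective_iff_bijective.1 hw), rfl⟩
    have h1 := f.map_perm e σ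
    have h2 := e.det.map_perm e σ
    simp only [Function.comp_def] at h1 h2
    simp [h1, h2, LinearMap.toSpanSingleton_apply, e.det_self]
  have hfe : f e = exteriorPower.ιMulti K k v := by
    simp only [f, AlternatingMap.compLinearMap_apply]
    congr 1
    funext i
    simp [e, Module.Basis.span_apply]
  rw [pluecker, Projectivization.mk_eq_mk_iff']
  refine ⟨e.det (Module.finBasisOfFinrankEq K _ hX), ?_⟩
  rw [← hfe]
  have := congrArg (fun F => F (Module.finBasisOfFinrankEq K _ hX)) hf
  simp only [LinearMap.compAlternatingMap_apply, LinearMap.toSpanSingleton_apply] at this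
  exact this.symm

end Pluecker

/-! ### The symplectic `k`-grassmannian and its Plücker embedding -/

section Symplectic

variable {K : Type*} [Field K] {V : Type*} [AddCommGroup V] [Module K V]

/-- `X` is totally isotropic for the form `f`. -/
def IsTotallyIsotropic (f : LinearMap.BilinForm K V) (X : Submodule K V) : Prop :=
  ∀ x ∈ X, ∀ y ∈ X, f x y = 0

/-- The points of the polar `k`-grassmannian: the totally isotropic subspaces of dimension `k`. -/
def GrassPoint (f : LinearMap.BilinForm K V) (k : ℕ) : Type _ :=
  {X : Submodule K V // Module.finrank K X = k ∧ IsTotallyIsotropic f X}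

/-- The lines of the polar `k`-grassmannian for `1 < k < n`: the `k`-shadows of the flags
`Z₁ ⊂ Z₂` of totally isotropic subspaces of dimensions `k - 1` and `k + 1`. -/
def grassLines (f : LinearMap.BilinForm K V) (k : ℕ) : Set (Set (GrassPoint f k)) :=
  {l | ∃ Z₁ Z₂ : Submodule K V,
    Module.finrank K Z₁ + 1 = k ∧ Module.finrank K Z₂ = k + 1 ∧
    IsTotallyIsotropic f Z₁ ∧ IsTotallyIsotropic f Z₂ ∧ Z₁ ≤ Z₂ ∧
    l = {X : GrassPoint f k | Z₁ ≤ X.1 ∧ X.1 ≤ Z₂}}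

/-- The Plücker map of the polar `k`-grassmannian, as a map into `PG(⋀ᵏ V)`. -/
def plueckerMap (f : LinearMap.BilinForm K V) {k : ℕ} (hk : 0 < k) :
    GrassPoint f k → ℙ K (⋀[K]^k V) :=
  fun X => pluecker hk X.1 X.2.1

/-- The Plücker embedding of the polar `k`-grassmannian; its codomain is the subspace of
`PG(⋀ᵏ V)` spanned by the image of the Plücker map. -/
def plueckerEmbedding (f : LinearMap.BilinForm K V) {k : ℕ} (hk : 0 < k) :
    GrassPoint f k → ℙ K (imageSpan (plueckerMap f hk)) :=
  toImageSpan (plueckerMap f hk)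

end Symplectic

end SymplecticGrassmann

end

namespace SymplecticGrassmann

/-! ### Decomposable vectors and lines on the Grassmann variety -/

section Wedge

variable {K : Type*} [Field K] {V : Type*} [AddCommGroup V] [Module K V]

/-! The lines of `Σ` inside the support are exactly the images of the pencils `{X | Z ≤ X ≤ W}` with
`Z` totally isotropic of dimension `k - 1`, `dim W = k + 1` and `W ≤ Z^⊥`
(`IsPencil.image_mem_projLines`, `exists_isPencil_of_subset_support`). Such a pencil is a line of
the grassmannian when `W` is totally isotropic; otherwise it is a hyperbolic pencil, and these
exist, so transparency fails.

The two kinds are told apart by collinearity in the support, which means `dim (X ⊓ Y) ≥ k - 1`. If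
`W` is not isotropic, every point collinear with the whole pencil contains `Z`, so any two such
points are collinear (`IsPencil.le_of_adjacent`). If `W` is isotropic, some point through `Z`
outside `W` and some point inside `W` not through `Z` are both collinear with the whole pencil but
not with each other (`IsPencil.exists_nonadjacent`).

Thus the image lines are recovered from the projective lines and the support alone
(`imageLines_grassLines_eq`), and a collineation that preserves the support preserves them. -/

theorem ι_mul_ιMulti {k : ℕ} (v : V) (u : Fin k → V) :
    ExteriorAlgebra.ι K v * ExteriorAlgebra.ιMulti K k u =
      ExteriorAlgebra.ιMulti K (k + 1) (Fin.cons v u) := by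
  rw [ExteriorAlgebra.ιMulti_succ_apply]
  rfl

theorem ιMulti_eq_zero_iff {k : ℕ} (u : Fin k → V) :
    exteriorPower.ιMulti K k u = 0 ↔ ¬ LinearIndependent K u :=
  ⟨fun h hu => wedge_ne_zero hu h, fun h => AlternatingMap.map_linearDependent _ u h⟩

theorem ι_mul_ιMulti_eq_zero_iff {k : ℕ} {u : Fin k → V} (hu : LinearIndependent K u) (v : V) :
    ExteriorAlgebra.ι K v * ExteriorAlgebra.ιMulti K k u = 0 ↔
      v ∈ Submodule.span K (Set.range u) := by
  rw [ι_mul_ιMulti, ← exteriorPower.ιMulti_apply_coe, ZeroMemClass.coe_eq_zero,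
    ιMulti_eq_zero_iff, linearIndependent_finCons]
  tauto

/-- Wedging on the left of `z₁ ∧ ⋯ ∧ zₘ`, as a linear map in the new factor. -/
def wedgeCons {m : ℕ} (z : Fin m → V) : V →ₗ[K] ⋀[K]^(m + 1) V where
  toFun v := exteriorPower.ιMulti K (m + 1) (Fin.cons v z)
  map_add' v w := (exteriorPower.ιMulti K (m + 1)).toMultilinearMap.cons_add z v w
  map_smul' c v := (exteriorPower.ιMulti K (m + 1)).toMultilinearMap.cons_smul z c v

theorem ker_wedgeCons {m : ℕ} {z : Fin m → V} (hz : LinearIndependent K z) :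
    LinearMap.ker (wedgeCons (K := K) z) = Submodule.span K (Set.range z) := by
  ext v
  rw [LinearMap.mem_ker]
  change exteriorPower.ιMulti K (m + 1) (Fin.cons v z) = 0 ↔ _
  rw [ιMulti_eq_zero_iff, linearIndependent_finCons]
  tauto

theorem exists_linearIndependent_span_eq {k : ℕ} (X : Submodule K V) [FiniteDimensional K X]
    (hX : Module.finrank K X = k) :
    ∃ u : Fin k → V, LinearIndependent K u ∧ Submodule.span K (Set.range u) = X := by
  let b := Module.finBasisOfFinrankEq K X hX
  refine ⟨fun i => b i, b.linearIndependent.map' X.subtype X.ker_subtype, ?_⟩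
  have h := congrArg (Submodule.map X.subtype) b.span_eq
  rw [Submodule.map_span, Submodule.map_top, Submodule.range_subtype, ← Set.range_comp] at h
  exact h

variable [FiniteDimensional K V]

/-- A vector representing the Plücker point of `X` is the wedge of a suitable basis of `X`. -/
theorem exists_basis_of_mk_eq_pluecker {k : ℕ} (hk : 0 < k) {X : Submodule K V}
    (hX : Module.finrank K X = k) {x : ⋀[K]^k V} (hx : x ≠ 0)
    (h : Projectivization.mk K x hx = pluecker hk X hX) :
    ∃ (c : K) (u : Fin k → V), c ≠ 0 ∧ LinearIndependent K u ∧
      Submodule.span K (Set.range u) = X ∧ x = c • exteriorPower.ιMulti K k u := by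
  obtain ⟨u, hu, hs⟩ := exists_linearIndependent_span_eq X hX
  rw [pluecker_eq hk X hX u hu hs, Projectivization.mk_eq_mk_iff'] at h
  obtain ⟨c, hc⟩ := h
  refine ⟨c, u, ?_, hu, hs, hc.symm⟩
  rintro rfl
  rw [zero_smul] at hc
  exact hx hc.symm

/-- The subspace is recovered from any vector on its Plücker point as the annihilator under wedging;
this yields injectivity and the adjacency argument below. -/
theorem mem_iff_of_mk_eq_pluecker {k : ℕ} (hk : 0 < k) {X : Submodule K V}
    (hX : Module.finrank K X = k) {x : ⋀[K]^k V} (hx : x ≠ 0)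
    (h : Projectivization.mk K x hx = pluecker hk X hX) (v : V) :
    v ∈ X ↔ ExteriorAlgebra.ι K v * (x : ExteriorAlgebra K V) = 0 := by
  obtain ⟨c, u, hc, hu, hs, rfl⟩ := exists_basis_of_mk_eq_pluecker hk hX hx h
  rw [← hs, ← ι_mul_ιMulti_eq_zero_iff hu, Submodule.coe_smul, mul_smul_comm,
    smul_eq_zero_iff_right hc, exteriorPower.ιMulti_apply_coe]

/-- For `v ∉ X` the vector `v ∧ x` is again nonzero and decomposable, with subspace `X ⊔ ⟨v⟩`, so
its annihilator is that sum. -/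
theorem mem_sup_iff_of_mk_eq_pluecker {k : ℕ} (hk : 0 < k) {X : Submodule K V}
    (hX : Module.finrank K X = k) {x : ⋀[K]^k V} (hx : x ≠ 0)
    (h : Projectivization.mk K x hx = pluecker hk X hX) {v : V} (hv : v ∉ X) (w : V) :
    w ∈ X ⊔ K ∙ v ↔
      ExteriorAlgebra.ι K w * (ExteriorAlgebra.ι K v * (x : ExteriorAlgebra K V)) = 0 := by
  obtain ⟨c, u, hc, hu, hs, rfl⟩ := exists_basis_of_mk_eq_pluecker hk hX hx h
  have hvu : LinearIndependent K (Fin.cons v u : Fin (k + 1) → V) :=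
    linearIndependent_finCons.2 ⟨hu, hs ▸ hv⟩
  rw [Submodule.coe_smul, mul_smul_comm, mul_smul_comm, smul_eq_zero_iff_right hc,
    exteriorPower.ιMulti_apply_coe, ι_mul_ιMulti, ι_mul_ιMulti_eq_zero_iff hvu, Fin.range_cons,
    Submodule.span_insert, hs, sup_comm]

theorem pluecker_injective {k : ℕ} (hk : 0 < k) {X Y : Submodule K V}
    (hX : Module.finrank K X = k) (hY : Module.finrank K Y = k)
    (h : pluecker hk X hX = pluecker hk Y hY) : X = Y := by
  ext v
  have h1 := Projectivization.mk_rep (pluecker hk X hX)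
  rw [mem_iff_of_mk_eq_pluecker hk hX _ h1, mem_iff_of_mk_eq_pluecker hk hY _ (h1.trans h)]

/-- If the sum of two decomposable vectors is decomposable, then the corresponding subspaces are
adjacent in the grassmannian. -/
theorem finrank_inf_of_add_decomposable {k : ℕ} (hk : 0 < k) {X Y U : Submodule K V}
    (hX : Module.finrank K X = k) (hY : Module.finrank K Y = k) (hU : Module.finrank K U = k)
    {x y w : ⋀[K]^k V} (hx : x ≠ 0) (hy : y ≠ 0) (hw : w ≠ 0)
    (hxy : w = x + y)
    (hpx : Projectivization.mk K x hx = pluecker hk X hX)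
    (hpy : Projectivization.mk K y hy = pluecker hk Y hY)
    (hpu : Projectivization.mk K w hw = pluecker hk U hU) (hne : X ≠ Y) :
    Module.finrank K ↥(X ⊓ Y) + 1 = k := by
  obtain ⟨v, hvU, hv⟩ : ∃ v ∈ U, v ∉ X ⊓ Y := by
    by_contra! hle
    have hle : U ≤ X ⊓ Y := hle
    have h1 := Submodule.eq_of_le_of_finrank_eq (hle.trans inf_le_left) (hU.trans hX.symm)
    have h2 := Submodule.eq_of_le_of_finrank_eq (hle.trans inf_le_right) (hU.trans hY.symm)
    exact hne (h1.symm.trans h2)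
  rw [mem_iff_of_mk_eq_pluecker hk hU hw hpu, hxy, Submodule.coe_add, mul_add] at hvU
  -- From `v ∧ x + v ∧ y = 0`, one summand vanishes exactly when the other does; hence `v` lies in
  -- neither subspace.
  have hXY : v ∈ X ↔ v ∈ Y := by
    rw [mem_iff_of_mk_eq_pluecker hk hX hx hpx, mem_iff_of_mk_eq_pluecker hk hY hy hpy]
    constructor <;> intro h <;> simpa [h] using hvU
  rw [Submodule.mem_inf, hXY, and_self] at hv
  have hvX : v ∉ X := fun h => hv (hXY.1 h)
  -- `v ∧ x = -(v ∧ y)` have the same annihilator, so `X ⊔ Y` lies in a space of dimension `k + 1`.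
  have hsup : X ⊔ K ∙ v = Y ⊔ K ∙ v := by
    ext w
    rw [mem_sup_iff_of_mk_eq_pluecker hk hX hx hpx hvX,
      mem_sup_iff_of_mk_eq_pluecker hk hY hy hpy hv, eq_neg_of_add_eq_zero_left hvU, mul_neg,
      neg_eq_zero]
  have h1 : Module.finrank K ↥(X ⊔ Y) ≤ k + 1 := by
    rw [← hX, ← Submodule.finrank_sup_span_singleton hvX]
    exact Submodule.finrank_mono (sup_le le_sup_left (hsup ▸ le_sup_left))
  have h2 := Submodule.finrank_sup_add_finrank_inf_eq X Y
  have h3 : Module.finrank K ↥(X ⊓ Y) < k := by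
    rw [← hX]
    refine Submodule.finrank_lt_finrank_of_lt (inf_le_left.lt_of_ne fun h => hne ?_)
    exact Submodule.eq_of_le_of_finrank_eq (inf_eq_left.1 h) (hX.trans hY.symm)
  omega

/-- The subspaces `X` with `Z < X < W`, where `Z` and `W` have codimension `2` in one another,
are mapped by the Plücker map onto the points of a projective line. -/
theorem exists_pencil_plane {k : ℕ} (hk : 0 < k) {Z W : Submodule K V}
    (hZ : Module.finrank K Z + 1 = k) (hW : Module.finrank K W = k + 1) (hZW : Z ≤ W) :
    ∃ U : Submodule K (⋀[K]^k V), Module.finrank K U = 2 ∧ ∀ p : ℙ K (⋀[K]^k V),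
      p.submodule ≤ U ↔ ∃ (X : Submodule K V) (hX : Module.finrank K X = k),
        Z ≤ X ∧ X ≤ W ∧ p = pluecker hk X hX := by
  obtain ⟨z, hz, hzs⟩ := exists_linearIndependent_span_eq Z rfl
  subst hZ
  have hker : LinearMap.ker (wedgeCons (K := K) z) = Z := (ker_wedgeCons hz).trans hzs
  have hmk : ∀ w : V, ∀ hw : w ∉ Z, ∀ h : wedgeCons (K := K) z w ≠ 0,
      Projectivization.mk K (wedgeCons (K := K) z w) h =
        pluecker hk (Z ⊔ K ∙ w) (Submodule.finrank_sup_span_singleton hw) := by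
    intro w hw h
    rw [pluecker_eq hk _ _ (Fin.cons w z) (linearIndependent_finCons.2 ⟨hz, hzs.symm ▸ hw⟩)]
    · rfl
    · rw [Fin.range_cons, Submodule.span_insert, hzs, sup_comm]
  -- Wedging with a basis of `Z` has kernel `Z`, so the image of `W` is a copy of the 2-dimensional
  -- quotient `W / Z`.
  refine ⟨W.map (wedgeCons z), ?_, fun p => ⟨?_, ?_⟩⟩
  · have h := LinearMap.finrank_range_add_finrank_ker ((wedgeCons (K := K) z).domRestrict W)
    rw [LinearMap.range_domRestrict, LinearMap.ker_domRestrict, hker,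
      (Submodule.comapSubtypeEquivOfLe hZW).finrank_eq] at h
    omega
  · induction p using Projectivization.ind with | _ y hy
    rw [Projectivization.submodule_mk, Submodule.span_singleton_le_iff_mem]
    rintro ⟨w, hw, rfl⟩
    have hwZ : w ∉ Z := by rwa [← hker, LinearMap.mem_ker]
    exact ⟨_, _, le_sup_left, sup_le hZW ((Submodule.span_singleton_le_iff_mem _ _).2 hw),
      hmk w hwZ hy⟩
  · rintro ⟨X, hX, hZX, hXW, rfl⟩
    obtain ⟨w, hwX, hwZ⟩ : ∃ w ∈ X, w ∉ Z := by
      by_contra! h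
      have := Submodule.finrank_mono (show X ≤ Z from h)
      omega
    have hXw : Z ⊔ K ∙ w = X := Submodule.eq_of_le_of_finrank_eq
      (sup_le hZX ((Submodule.span_singleton_le_iff_mem _ _).2 hwX))
      ((Submodule.finrank_sup_span_singleton hwZ).trans hX.symm)
    have hne : wedgeCons (K := K) z w ≠ 0 := fun h => hwZ (hker ▸ LinearMap.mem_ker.2 h)
    have h := hmk w hwZ hne
    simp only [hXw] at h
    rw [← h, Projectivization.submodule_mk, Submodule.span_singleton_le_iff_mem]
    exact Submodule.mem_map_of_mem (hXW hwX)

end Wedge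

/-! ### Isotropic subspaces and pencils in the symplectic space -/

section Pencil

variable {K : Type*} [Field K] {V : Type*} [AddCommGroup V] [Module K V]

theorem IsTotallyIsotropic.mono {f : LinearMap.BilinForm K V} {X Y : Submodule K V}
    (hY : IsTotallyIsotropic f Y) (h : X ≤ Y) : IsTotallyIsotropic f X :=
  fun x hx y hy => hY x (h hx) y (h hy)

theorem IsTotallyIsotropic.le_orthogonal {f : LinearMap.BilinForm K V} {X Y : Submodule K V}
    (hY : IsTotallyIsotropic f Y) (h : X ≤ Y) : Y ≤ f.orthogonal X :=
  fun y hy x hx => hY x (h hx) y hy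

theorem IsTotallyIsotropic.sup {f : LinearMap.BilinForm K V} (hf : f.IsAlt)
    {X Y : Submodule K V} (hX : IsTotallyIsotropic f X) (hY : IsTotallyIsotropic f Y)
    (h : Y ≤ f.orthogonal X) : IsTotallyIsotropic f (X ⊔ Y) := by
  intro u hu v hv
  obtain ⟨x, hx, y, hy, rfl⟩ := Submodule.mem_sup.1 hu
  obtain ⟨x', hx', y', hy', rfl⟩ := Submodule.mem_sup.1 hv
  have h1 : f x y' = 0 := h hy' x hx
  have h2 : f y x' = 0 := hf.isRefl _ _ (h hy x' hx')
  simp [hX x hx x' hx', hY y hy y' hy', h1, h2]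

theorem isTotallyIsotropic_span_singleton {f : LinearMap.BilinForm K V} (hf : f.IsAlt) (v : V) :
    IsTotallyIsotropic f (K ∙ v) := by
  intro x hx y hy
  obtain ⟨a, rfl⟩ := Submodule.mem_span_singleton.1 hx
  obtain ⟨b, rfl⟩ := Submodule.mem_span_singleton.1 hy
  simp [hf.self_eq_zero v]

theorem IsTotallyIsotropic.sup_span_singleton {f : LinearMap.BilinForm K V} (hf : f.IsAlt)
    {X : Submodule K V} (hX : IsTotallyIsotropic f X) {v : V} (hv : v ∈ f.orthogonal X) :
    IsTotallyIsotropic f (X ⊔ K ∙ v) :=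
  hX.sup hf (isTotallyIsotropic_span_singleton hf v)
    ((Submodule.span_singleton_le_iff_mem _ _).2 hv)

/-- The flags `Z ≤ W` all of whose intermediate subspaces of dimension `k` are totally
isotropic. -/
structure IsPencil (f : LinearMap.BilinForm K V) (k : ℕ) (Z W : Submodule K V) : Prop where
  finrank_left : Module.finrank K Z + 1 = k
  finrank_right : Module.finrank K W = k + 1
  isotropic : IsTotallyIsotropic f Z
  le : Z ≤ W
  le_orthogonal : W ≤ f.orthogonal Z

/-- The points of the `k`-grassmannian between `Z` and `W`. -/
def pencil (f : LinearMap.BilinForm K V) (k : ℕ) (Z W : Submodule K V) : Set (GrassPoint f k) :=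
  {X | Z ≤ X.1 ∧ X.1 ≤ W}

theorem mem_grassLines_iff {f : LinearMap.BilinForm K V} {k : ℕ} {l : Set (GrassPoint f k)} :
    l ∈ grassLines f k ↔
      ∃ Z W, IsPencil f k Z W ∧ IsTotallyIsotropic f W ∧ l = pencil f k Z W := by
  constructor
  · rintro ⟨Z, W, h1, h2, h3, h4, h5, rfl⟩
    exact ⟨Z, W, ⟨h1, h2, h3, h5, h4.le_orthogonal h5⟩, h4, rfl⟩
  · rintro ⟨Z, W, ⟨h1, h2, h3, h5, -⟩, h4, rfl⟩
    exact ⟨Z, W, h1, h2, h3, h4, h5, rfl⟩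

variable {f : LinearMap.BilinForm K V} {k : ℕ} {Z W : Submodule K V} [FiniteDimensional K V]

theorem sup_span_singleton_eq_of_finrank {X : Submodule K V}
    (hX : Module.finrank K X = Module.finrank K Z + 1) (hZX : Z ≤ X) {w : V} (hwX : w ∈ X)
    (hwZ : w ∉ Z) : Z ⊔ K ∙ w = X :=
  Submodule.eq_of_le_of_finrank_eq
    (sup_le hZX ((Submodule.span_singleton_le_iff_mem _ _).2 hwX))
    ((Submodule.finrank_sup_span_singleton hwZ).trans hX.symm)

theorem exists_mem_notMem_of_finrank_lt {X Y : Submodule K V}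
    (h : Module.finrank K Y < Module.finrank K X) : ∃ w ∈ X, w ∉ Y := by
  by_contra! hle
  have := Submodule.finrank_mono (show X ≤ Y from hle)
  omega

theorem IsPencil.isTotallyIsotropic (h : IsPencil f k Z W) (hf : f.IsAlt) {X : Submodule K V}
    (hX : Module.finrank K X = k) (hZX : Z ≤ X) (hXW : X ≤ W) : IsTotallyIsotropic f X := by
  have hk := h.finrank_left
  obtain ⟨w, hwX, hwZ⟩ := exists_mem_notMem_of_finrank_lt
    (show Module.finrank K Z < Module.finrank K X by omega)
  rw [← sup_span_singleton_eq_of_finrank (hX.trans hk.symm) hZX hwX hwZ]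
  exact h.isotropic.sup_span_singleton hf (h.le_orthogonal (hXW hwX))

/-- `X ⊓ Y` is orthogonal to both `X` and `Y`, hence to their sum; `X` and `Y` need not be
orthogonal to each other, which is how hyperbolic pencils arise. -/
theorem isPencil_inf_sup (X Y : GrassPoint f k) (h : Module.finrank K ↥(X.1 ⊓ Y.1) + 1 = k) :
    IsPencil f k (X.1 ⊓ Y.1) (X.1 ⊔ Y.1) where
  finrank_left := h
  finrank_right := by
    have h1 := Submodule.finrank_sup_add_finrank_inf_eq X.1 Y.1
    rw [X.2.1, Y.2.1] at h1
    omega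
  isotropic := X.2.2.mono inf_le_left
  le := inf_le_left.trans le_sup_left
  le_orthogonal := sup_le (X.2.2.le_orthogonal inf_le_left) (Y.2.2.le_orthogonal inf_le_right)

theorem finrank_inf_lt_of_ne {X Y : GrassPoint f k} (h : X ≠ Y) :
    Module.finrank K ↥(X.1 ⊓ Y.1) < k := by
  conv_rhs => rw [← X.2.1]
  refine Submodule.finrank_lt_finrank_of_lt (inf_le_left.lt_of_ne fun h' => h (Subtype.ext ?_))
  exact Submodule.eq_of_le_of_finrank_eq (inf_eq_left.1 h') (X.2.1.trans Y.2.1.symm)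

theorem IsPencil.exists_pair (h : IsPencil f k Z W) (hf : f.IsAlt) :
    ∃ X ∈ pencil f k Z W, ∃ Y ∈ pencil f k Z W, X.1 ⊓ Y.1 = Z ∧ X.1 ⊔ Y.1 = W := by
  have hk := h.finrank_left
  have hW := h.finrank_right
  have key : ∀ w ∈ W, w ∉ Z → ∃ X ∈ pencil f k Z W, X.1 = Z ⊔ K ∙ w := by
    intro w hw hwZ
    have h1 : Z ⊔ K ∙ w ≤ W := sup_le h.le ((Submodule.span_singleton_le_iff_mem _ _).2 hw)
    have h2 := (Submodule.finrank_sup_span_singleton hwZ).trans hk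
    exact ⟨⟨_, h2, h.isTotallyIsotropic hf h2 le_sup_left h1⟩, ⟨le_sup_left, h1⟩, rfl⟩
  obtain ⟨a, haW, haZ⟩ := exists_mem_notMem_of_finrank_lt
    (show Module.finrank K Z < Module.finrank K W by omega)
  obtain ⟨X, hX, hXa⟩ := key a haW haZ
  obtain ⟨b, hbW, hbX⟩ := exists_mem_notMem_of_finrank_lt
    (show Module.finrank K X.1 < Module.finrank K W by rw [X.2.1]; omega)
  obtain ⟨Y, hY, hYb⟩ := key b hbW fun hb => hbX (hX.1 hb)
  have hbY : b ∈ Y.1 := by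
    rw [hYb]
    exact Submodule.mem_sup_right (Submodule.mem_span_singleton_self b)
  have hlt := finrank_inf_lt_of_ne (X := X) (Y := Y) (by rintro rfl; exact hbX hbY)
  have hinf : Z = X.1 ⊓ Y.1 :=
    Submodule.eq_of_le_of_finrank_le (le_inf hX.1 hY.1) (by omega)
  refine ⟨X, hX, Y, hY, hinf.symm, ?_⟩
  have hp := isPencil_inf_sup X Y (by rw [← hinf, hk])
  exact Submodule.eq_of_le_of_finrank_eq (sup_le hX.2 hY.2) (hp.finrank_right.trans hW.symm)

/-- If `Z` were not in `P`, then `P` would lie in `W` and span it together with `Z`. As `P` and `Z`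
are isotropic and `W ≤ Z^⊥`, this would make `W` isotropic. -/
theorem IsPencil.le_of_adjacent (h : IsPencil f k Z W) (hf : f.IsAlt)
    (hW : ¬ IsTotallyIsotropic f W) (P : GrassPoint f k)
    (hP : ∀ X ∈ pencil f k Z W, k ≤ Module.finrank K ↥(P.1 ⊓ X.1) + 1) : Z ≤ P.1 := by
  by_contra hZP
  obtain ⟨X, hX, Y, hY, hinf, hsup⟩ := h.exists_pair hf
  have hk := h.finrank_left
  have h1 := Submodule.finrank_sup_add_finrank_inf_eq (P.1 ⊓ X.1) (P.1 ⊓ Y.1)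
  have h2 : (P.1 ⊓ X.1) ⊓ (P.1 ⊓ Y.1) = P.1 ⊓ Z := by rw [← inf_inf_distrib_left, hinf]
  have h3 : Module.finrank K ↥(P.1 ⊓ Z) < Module.finrank K Z :=
    Submodule.finrank_lt_finrank_of_lt (inf_le_right.lt_of_ne fun h' => hZP (inf_eq_right.1 h'))
  have h4 := hP X hX
  have h5 := hP Y hY
  -- Two subspaces of dimension at least `k - 1` meeting in `P ⊓ Z`, of dimension at most `k - 2`,
  -- already fill `P`.
  have h6 : (P.1 ⊓ X.1) ⊔ (P.1 ⊓ Y.1) = P.1 := by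
    refine Submodule.eq_of_le_of_finrank_le (sup_le inf_le_left inf_le_left) ?_
    rw [h2] at h1
    rw [P.2.1]
    omega
  have hPW : P.1 ≤ W := by
    rw [← h6]
    exact sup_le (inf_le_right.trans hX.2) (inf_le_right.trans hY.2)
  have h7 : Z ⊔ P.1 = W := by
    refine Submodule.eq_of_le_of_finrank_le (sup_le h.le hPW) ?_
    have h8 := Submodule.finrank_sup_add_finrank_inf_eq Z P.1
    rw [inf_comm, P.2.1] at h8
    rw [h.finrank_right]
    omega
  exact hW (h7 ▸ h.isotropic.sup hf P.2.2 (hPW.trans h.le_orthogonal))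

theorem IsPencil.exists_nonadjacent (h : IsPencil f k Z W) (hf : f.IsAlt) (hnd : f.Nondegenerate)
    (hW : IsTotallyIsotropic f W) (hk : 1 < k) (hV : 2 * k < Module.finrank K V) :
    ∃ P Q : GrassPoint f k, Module.finrank K ↥(P.1 ⊓ Q.1) + 1 < k ∧
      ∀ X ∈ pencil f k Z W, k ≤ Module.finrank K ↥(P.1 ⊓ X.1) + 1 ∧
        k ≤ Module.finrank K ↥(Q.1 ⊓ X.1) + 1 := by
  have hZk := h.finrank_left
  have hWk := h.finrank_right
  have horth := LinearMap.BilinForm.finrank_orthogonal hnd Z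
  -- `dim Z^⊥ = dim V - (k - 1)` exceeds `k + 1` precisely because `2k < dim V`.
  obtain ⟨c, hc, hcW⟩ := exists_mem_notMem_of_finrank_lt
    (show Module.finrank K W < Module.finrank K (f.orthogonal Z) by omega)
  have hcZ : c ∉ Z := fun hcZ => hcW (h.le hcZ)
  obtain ⟨P, hPdef⟩ : ∃ P : GrassPoint f k, P.1 = Z ⊔ K ∙ c :=
    ⟨⟨_, (Submodule.finrank_sup_span_singleton hcZ).trans hZk,
      h.isotropic.sup_span_singleton hf hc⟩, rfl⟩
  have hZP : Z ≤ P.1 := hPdef ▸ le_sup_left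
  have hcP : c ∈ P.1 :=
    hPdef ▸ Submodule.mem_sup_right (Submodule.mem_span_singleton_self c)
  have hPW : P.1 ⊓ W = Z := by
    refine (Submodule.eq_of_le_of_finrank_le (le_inf hZP h.le) ?_).symm
    have h1 : Module.finrank K ↥(P.1 ⊓ W) < Module.finrank K P.1 :=
      Submodule.finrank_lt_finrank_of_lt
        (inf_le_left.lt_of_ne fun h' => hcW (inf_eq_left.1 h' hcP))
    rw [P.2.1] at h1
    omega
  -- Here `1 < k` enters: `Z` is nonzero, so some hyperplane `ker φ` of `V` fails to contain it, and
  -- `Q = W ⊓ ker φ` is a hyperplane of `W` not containing `Z`.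
  obtain ⟨z, hzZ, hz0⟩ := Z.exists_mem_ne_zero_of_ne_bot
    (by rintro rfl; rw [finrank_bot] at hZk; omega)
  obtain ⟨φ, hφz, -⟩ := Submodule.exists_le_ker_of_notMem
    (show z ∉ (⊥ : Submodule K V) by simpa using hz0)
  have hφ := Module.Dual.finrank_ker_add_one_of_ne_zero
    (show φ ≠ 0 by rintro rfl; exact hφz rfl)
  have hQ : Module.finrank K ↥(W ⊓ LinearMap.ker φ) = k := by
    have h1 := Submodule.finrank_sup_add_finrank_inf_eq W (LinearMap.ker φ)
    have h2 := Submodule.finrank_le (W ⊔ LinearMap.ker φ)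
    have h3 : Module.finrank K ↥(W ⊓ LinearMap.ker φ) < Module.finrank K W :=
      Submodule.finrank_lt_finrank_of_lt
        (inf_le_left.lt_of_ne fun h' => hφz (inf_eq_left.1 h' (h.le hzZ)))
    omega
  refine ⟨P, ⟨_, hQ, hW.mono inf_le_left⟩, ?_, fun X hX => ⟨?_, ?_⟩⟩
  · change Module.finrank K ↥(P.1 ⊓ (W ⊓ LinearMap.ker φ)) + 1 < k
    have h1 : P.1 ⊓ (W ⊓ LinearMap.ker φ) < Z := by
      rw [← inf_assoc, hPW]
      exact inf_le_left.lt_of_ne fun h' => hφz (inf_eq_left.1 h' hzZ)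
    have h2 := Submodule.finrank_lt_finrank_of_lt h1
    omega
  · have h1 := Submodule.finrank_mono (le_inf hZP hX.1)
    omega
  -- Both `Q` and `X` are hyperplanes of `W`, so they meet in dimension at least `k - 1`.
  · have h1 := Submodule.finrank_sup_add_finrank_inf_eq (W ⊓ LinearMap.ker φ) X.1
    have h2 := Submodule.finrank_mono (sup_le inf_le_left hX.2 : (W ⊓ LinearMap.ker φ) ⊔ X.1 ≤ W)
    rw [X.2.1] at h1
    change k ≤ Module.finrank K ↥((W ⊓ LinearMap.ker φ) ⊓ X.1) + 1
    omega

theorem exists_isTotallyIsotropic_finrank_eq (hf : f.IsAlt) (hnd : f.Nondegenerate) (j : ℕ)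
    (hj : 2 * j ≤ Module.finrank K V) :
    ∃ X : Submodule K V, Module.finrank K X = j ∧ IsTotallyIsotropic f X := by
  induction j with
  | zero => exact ⟨⊥, finrank_bot K V, by rintro x hx y -; simp [(Submodule.mem_bot K).1 hx]⟩
  | succ j ih =>
    obtain ⟨X, hX, hiso⟩ := ih (by omega)
    have horth := LinearMap.BilinForm.finrank_orthogonal hnd X
    obtain ⟨c, hc, hcX⟩ := exists_mem_notMem_of_finrank_lt
      (show Module.finrank K X < Module.finrank K (f.orthogonal X) by omega)
    exact ⟨_, (Submodule.finrank_sup_span_singleton hcX).trans (by rw [hX]),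
      hiso.sup_span_singleton hf hc⟩

theorem IsTotallyIsotropic.two_mul_finrank_le (hnd : f.Nondegenerate) {X : Submodule K V}
    (hX : IsTotallyIsotropic f X) : 2 * Module.finrank K X ≤ Module.finrank K V := by
  have h1 := Submodule.finrank_mono (hX.le_orthogonal le_rfl)
  have h2 := LinearMap.BilinForm.finrank_orthogonal hnd X
  have h3 := Submodule.finrank_le X
  omega

/-- `Z^⊥` is too large to be isotropic, so it contains a non-orthogonal pair `a`, `b`; adjoining
both to `Z` gives a hyperbolic pencil. -/
theorem exists_isPencil_not_isotropic (hf : f.IsAlt) (hnd : f.Nondegenerate) (hk : 0 < k)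
    (hV : 2 * k ≤ Module.finrank K V) :
    ∃ Z W, IsPencil f k Z W ∧ ¬ IsTotallyIsotropic f W := by
  obtain ⟨Z, hZ, hiso⟩ := exists_isTotallyIsotropic_finrank_eq hf hnd (k - 1) (by omega)
  have horth := LinearMap.BilinForm.finrank_orthogonal hnd Z
  have hnot : ¬ IsTotallyIsotropic f (f.orthogonal Z) := fun h => by
    have := h.two_mul_finrank_le hnd
    omega
  simp only [IsTotallyIsotropic, not_forall] at hnot
  obtain ⟨a, ha, b, hb, hab⟩ := hnot
  have haZ : a ∉ Z := fun h => hab (hb a h)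
  have hbZ : b ∉ Z ⊔ K ∙ a := fun h => by
    refine hab (hiso.sup_span_singleton hf ha a ?_ b h)
    exact Submodule.mem_sup_right (Submodule.mem_span_singleton_self a)
  refine ⟨Z, (Z ⊔ K ∙ a) ⊔ K ∙ b, ⟨by omega, ?_, hiso, le_sup_left.trans le_sup_left, ?_⟩, ?_⟩
  · rw [Submodule.finrank_sup_span_singleton hbZ, Submodule.finrank_sup_span_singleton haZ]
    omega
  · simp only [sup_le_iff, Submodule.span_singleton_le_iff_mem]
    exact ⟨⟨hiso.le_orthogonal le_rfl, ha⟩, hb⟩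
  · intro h
    refine hab (h a ?_ b ?_)
    · exact Submodule.mem_sup_left
        (Submodule.mem_sup_right (Submodule.mem_span_singleton_self a))
    · exact Submodule.mem_sup_right (Submodule.mem_span_singleton_self b)

end Pencil

/-! ### An incidence-theoretic class of lines and its invariance -/

section BranchedLines

variable {α : Type*}

/-- Two points are collinear in `T` if they are equal or on a line of `L` contained in `T`. -/
def IsCollinearIn (L : Set (Set α)) (T : Set α) (p q : α) : Prop :=
  p = q ∨ ∃ S ∈ L, S ⊆ T ∧ p ∈ S ∧ q ∈ S

/-- The lines of `L` contained in `T` all of whose points are collinear in `T` with two points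
that are not collinear with each other. -/
def branchedLines (L : Set (Set α)) (T : Set α) : Set (Set α) :=
  {S | S ∈ L ∧ S ⊆ T ∧ ∃ p ∈ T, ∃ q ∈ T, ¬ IsCollinearIn L T p q ∧
    ∀ r ∈ S, IsCollinearIn L T p r ∧ IsCollinearIn L T q r}

variable {G : Type*} [Group G] [MulAction G α] {L : Set (Set α)} {T : Set α}

theorem IsCollinearIn.smul {g : G} (hL : g • L = L) (hT : g • T = T) {p q : α}
    (h : IsCollinearIn L T p q) : IsCollinearIn L T (g • p) (g • q) := by
  obtain rfl | ⟨S, hS, hST, hp, hq⟩ := h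
  · exact Or.inl rfl
  · exact Or.inr ⟨g • S, hL ▸ Set.smul_mem_smul_set hS, hT ▸ Set.smul_set_mono hST,
      Set.smul_mem_smul_set hp, Set.smul_mem_smul_set hq⟩

theorem smul_mem_branchedLines {g : G} (hL : g • L = L) (hT : g • T = T) {S : Set α}
    (hS : S ∈ branchedLines L T) : g • S ∈ branchedLines L T := by
  obtain ⟨hSL, hST, p, hp, q, hq, hpq, h⟩ := hS
  refine ⟨hL ▸ Set.smul_mem_smul_set hSL, hT ▸ Set.smul_set_mono hST,
    g • p, hT ▸ Set.smul_mem_smul_set hp, g • q, hT ▸ Set.smul_mem_smul_set hq, fun h' => hpq ?_, ?_⟩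
  · have h1 := h'.smul (inv_smul_eq_iff.2 hL.symm) (inv_smul_eq_iff.2 hT.symm)
    rwa [inv_smul_smul, inv_smul_smul] at h1
  · rintro _ ⟨r, hr, rfl⟩
    exact ⟨(h r hr).1.smul hL hT, (h r hr).2.smul hL hT⟩

/-- The class is defined from `L` and `T` alone, so it is stable under `g` and under `g⁻¹`; together
these give equality. -/
theorem smul_branchedLines {g : G} (hL : g • L = L) (hT : g • T = T) :
    g • branchedLines L T = branchedLines L T := by
  refine Set.Subset.antisymm ?_ ?_
  · rintro _ ⟨S, hS, rfl⟩
    exact smul_mem_branchedLines hL hT hS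
  · rw [Set.subset_smul_set_iff]
    rintro _ ⟨S, hS, rfl⟩
    exact smul_mem_branchedLines (inv_smul_eq_iff.2 hL.symm) (inv_smul_eq_iff.2 hT.symm) hS

end BranchedLines

/-! ### Lines of the support of the Plücker embedding -/

section Embedding

/-- A projective line is determined by two of its points, with a third point on it. -/
theorem exists_points_of_mem_projLines {K E : Type*} [Field K] [AddCommGroup E] [Module K E]
    {S : Set (ℙ K E)} (hS : S ∈ projLines K E) :
    ∃ (x y : E) (hx : x ≠ 0) (hy : y ≠ 0) (hxy : x + y ≠ 0), Projectivization.mk K x hx ∈ S ∧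
      Projectivization.mk K y hy ∈ S ∧ Projectivization.mk K (x + y) hxy ∈ S ∧
      Projectivization.mk K x hx ≠ Projectivization.mk K y hy ∧
      ∀ S' ∈ projLines K E, Projectivization.mk K x hx ∈ S' → Projectivization.mk K y hy ∈ S' →
        S = S' := by
  obtain ⟨U, hU, rfl⟩ := hS
  have : FiniteDimensional K U := Module.finite_of_finrank_pos (by omega)
  obtain ⟨b, hb, hbU⟩ := exists_linearIndependent_span_eq U hU
  have hpair := LinearIndependent.pair_iff.1 (show LinearIndependent K ![b 0, b 1] by
    convert hb using 1
    ext i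
    fin_cases i <;> rfl)
  have hmem : ∀ (U' : Submodule K E) (v : E) (hv : v ≠ 0),
      Projectivization.mk K v hv ∈ {p : ℙ K E | p.submodule ≤ U'} ↔ v ∈ U' := fun U' v hv => by
    rw [Set.mem_ofPred_eq, Projectivization.submodule_mk, Submodule.span_singleton_le_iff_mem]
  have h0 : b 0 ∈ U := hbU ▸ Submodule.subset_span ⟨0, rfl⟩
  have h1 : b 1 ∈ U := hbU ▸ Submodule.subset_span ⟨1, rfl⟩
  refine ⟨b 0, b 1, hb.ne_zero 0, hb.ne_zero 1,
    fun h => one_ne_zero (hpair 1 1 (by simpa using h)).1, (hmem U _ _).2 h0, (hmem U _ _).2 h1,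
    (hmem U _ _).2 (add_mem h0 h1), fun h => ?_, ?_⟩
  · obtain ⟨c, hc⟩ := (Projectivization.mk_eq_mk_iff' K _ _ _ _).1 h
    exact one_ne_zero (hpair 1 (-c) (by rw [one_smul, neg_smul, hc, add_neg_cancel])).1
  · rintro _ ⟨U', hU', rfl⟩ hx hy
    rw [hmem] at hx hy
    have : FiniteDimensional K U' := Module.finite_of_finrank_pos (by omega)
    have hUU' : U = U' := by
      refine Submodule.eq_of_le_of_finrank_eq ?_ (hU.trans hU'.symm)
      rw [← hbU, Submodule.span_le]
      rintro _ ⟨i, rfl⟩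
      fin_cases i
      exacts [hx, hy]
    rw [hUU']

variable {K : Type*} [Field K] {V : Type*} [AddCommGroup V] [Module K V]
variable {f : LinearMap.BilinForm K V} {k : ℕ} {Z W : Submodule K V}

theorem mk_eq_plueckerEmbedding_iff (hk : 0 < k) {v : imageSpan (plueckerMap f hk)} (hv : v ≠ 0)
    (X : GrassPoint f k) :
    Projectivization.mk K v hv = plueckerEmbedding f hk X ↔
      Projectivization.mk K (v : ⋀[K]^k V) (fun h => hv (Subtype.ext h)) =
        pluecker hk X.1 X.2.1 := by
  rw [← (Projectivization.map_injective (imageSpan (plueckerMap f hk)).subtype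
    (imageSpan _).injective_subtype).eq_iff, plueckerEmbedding, map_toImageSpan,
    Projectivization.map_mk]
  rfl

variable [FiniteDimensional K V]

theorem plueckerEmbedding_injective (hk : 0 < k) :
    Function.Injective (plueckerEmbedding f hk) := by
  intro X Y h
  have h1 := congrArg (Projectivization.map _ (imageSpan (plueckerMap f hk)).injective_subtype) h
  rw [plueckerEmbedding, map_toImageSpan, map_toImageSpan] at h1
  exact Subtype.ext (pluecker_injective hk X.2.1 Y.2.1 h1)

theorem IsPencil.image_mem_projLines (h : IsPencil f k Z W) (hf : f.IsAlt) (hk : 0 < k) :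
    plueckerEmbedding f hk '' pencil f k Z W ∈ projLines K (imageSpan (plueckerMap f hk)) := by
  obtain ⟨U, hU, hmem⟩ := exists_pencil_plane hk h.finrank_left h.finrank_right h.le
  -- Every nonzero vector of `U` represents an intermediate subspace, which is automatically
  -- isotropic, so the line already lies in `Σ`.
  have hle : U ≤ imageSpan (plueckerMap f hk) := by
    intro y hy
    by_cases hy0 : y = 0
    · rw [hy0]
      exact zero_mem _
    obtain ⟨X, hX, hZX, hXW, he⟩ := (hmem (Projectivization.mk K y hy0)).1 (by
      rwa [Projectivization.submodule_mk, Submodule.span_singleton_le_iff_mem])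
    refine le_iSup (fun Y => (plueckerMap f hk Y).submodule)
      ⟨X, hX, h.isTotallyIsotropic hf hX hZX hXW⟩ ?_
    change y ∈ (pluecker hk X hX).submodule
    rw [← he, Projectivization.submodule_mk]
    exact Submodule.mem_span_singleton_self y
  refine ⟨U.comap (imageSpan (plueckerMap f hk)).subtype,
    (Submodule.comapSubtypeEquivOfLe hle).finrank_eq.trans hU, ?_⟩
  ext p
  induction p using Projectivization.ind with | _ v hv
  have hv' : (v : ⋀[K]^k V) ≠ 0 := fun h => hv (Subtype.ext h)
  have h1 := hmem (Projectivization.mk K (v : ⋀[K]^k V) hv')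
  rw [Projectivization.submodule_mk, Submodule.span_singleton_le_iff_mem] at h1
  rw [Set.mem_ofPred_eq, Projectivization.submodule_mk, Submodule.span_singleton_le_iff_mem,
    Submodule.mem_comap, Submodule.subtype_apply, h1]
  constructor
  · rintro ⟨X, hX, he⟩
    exact ⟨X.1, X.2.1, hX.1, hX.2, (mk_eq_plueckerEmbedding_iff hk hv X).1 he.symm⟩
  · rintro ⟨X, hX, hZX, hXW, he⟩
    let P : GrassPoint f k := ⟨X, hX, h.isTotallyIsotropic hf hX hZX hXW⟩
    have hP : Projectivization.mk K v hv = plueckerEmbedding f hk P :=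
      (mk_eq_plueckerEmbedding_iff hk hv P).2 he
    exact ⟨P, ⟨hZX, hXW⟩, hP.symm⟩

/-- Three points `x`, `y`, `x + y` of the line suffice: their decomposability forces `X` and `Y` to
be adjacent, and the pencil they span has as image a projective line through the same two points. -/
theorem exists_isPencil_of_subset_support (hf : f.IsAlt) (hk : 0 < k)
    {S : Set (ℙ K (imageSpan (plueckerMap f hk)))}
    (hS : S ∈ projLines K (imageSpan (plueckerMap f hk)))
    (hST : S ⊆ support (plueckerEmbedding f hk)) :
    ∃ Z W, IsPencil f k Z W ∧ S = plueckerEmbedding f hk '' pencil f k Z W := by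
  obtain ⟨x, y, hx, hy, hxy, hxS, hyS, hxyS, hne, huniq⟩ := exists_points_of_mem_projLines hS
  obtain ⟨X, hX⟩ := hST hxS
  obtain ⟨Y, hY⟩ := hST hyS
  obtain ⟨P, hP⟩ := hST hxyS
  have hX1 := (mk_eq_plueckerEmbedding_iff hk hx X).1 hX.symm
  have hY1 := (mk_eq_plueckerEmbedding_iff hk hy Y).1 hY.symm
  have hP1 := (mk_eq_plueckerEmbedding_iff hk hxy P).1 hP.symm
  have hXY : X.1 ≠ Y.1 := fun h => hne (by rw [← hX, ← hY, Subtype.ext h])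
  have hp := isPencil_inf_sup X Y (finrank_inf_of_add_decomposable hk X.2.1 Y.2.1 P.2.1 _ _ _
    (Submodule.coe_add x y) hX1 hY1 hP1 hXY)
  refine ⟨_, _, hp, huniq _ (hp.image_mem_projLines hf hk) ?_ ?_⟩
  · exact ⟨X, ⟨inf_le_left, le_sup_left⟩, hX⟩
  · exact ⟨Y, ⟨inf_le_right, le_sup_right⟩, hY⟩

/-- The inequality covers equal points and adjacent ones at once; lines of both kinds count here. -/
theorem isCollinearIn_support_iff (hf : f.IsAlt) (hk : 0 < k) (X Y : GrassPoint f k) :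
    IsCollinearIn (projLines K (imageSpan (plueckerMap f hk))) (support (plueckerEmbedding f hk))
      (plueckerEmbedding f hk X) (plueckerEmbedding f hk Y) ↔
        k ≤ Module.finrank K ↥(X.1 ⊓ Y.1) + 1 := by
  have hinj := plueckerEmbedding_injective (f := f) hk
  constructor
  · rintro (h | ⟨S, hS, hST, hX, hY⟩)
    · rw [hinj h, inf_idem, Y.2.1]
      omega
    · obtain ⟨Z, W, hp, rfl⟩ := exists_isPencil_of_subset_support hf hk hS hST
      rw [hinj.mem_set_image] at hX hY
      have h1 := Submodule.finrank_mono (le_inf hX.1 hY.1)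
      have h2 := hp.finrank_left
      omega
  · intro h
    by_cases hXY : X = Y
    · exact Or.inl (hXY ▸ rfl)
    · have hlt := finrank_inf_lt_of_ne hXY
      have hp := isPencil_inf_sup X Y (by omega)
      exact Or.inr ⟨_, hp.image_mem_projLines hf hk, Set.image_subset_range _ _,
        Set.mem_image_of_mem _ ⟨inf_le_left, le_sup_left⟩,
        Set.mem_image_of_mem _ ⟨inf_le_right, le_sup_right⟩⟩

theorem IsPencil.image_mem_branchedLines_iff (h : IsPencil f k Z W) (hf : f.IsAlt)
    (hnd : f.Nondegenerate) (hk : 1 < k) (hV : 2 * k < Module.finrank K V) :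
    plueckerEmbedding f (zero_lt_one.trans hk) '' pencil f k Z W ∈
      branchedLines (projLines K (imageSpan (plueckerMap f (zero_lt_one.trans hk))))
        (support (plueckerEmbedding f (zero_lt_one.trans hk))) ↔ IsTotallyIsotropic f W := by
  constructor
  · rintro ⟨-, -, _, ⟨P, rfl⟩, _, ⟨Q, rfl⟩, hPQ, hall⟩
    by_contra hW
    simp only [Set.forall_mem_image, isCollinearIn_support_iff hf] at hPQ hall
    have hP := h.le_of_adjacent hf hW P fun X hX => (hall hX).1
    have hQ := h.le_of_adjacent hf hW Q fun X hX => (hall hX).2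
    have h1 := Submodule.finrank_mono (le_inf hP hQ)
    have h2 := h.finrank_left
    omega
  · intro hW
    obtain ⟨P, Q, hPQ, hall⟩ := h.exists_nonadjacent hf hnd hW hk hV
    refine ⟨h.image_mem_projLines hf _, Set.image_subset_range _ _, _, ⟨P, rfl⟩, _, ⟨Q, rfl⟩, ?_⟩
    simp only [Set.forall_mem_image, isCollinearIn_support_iff hf, not_le]
    exact ⟨hPQ, fun X hX => hall X hX⟩

/-- The right-hand side involves only the lines of `Σ` and the support, which is what makes the
image lines invariant. -/
theorem imageLines_grassLines_eq (hf : f.IsAlt) (hnd : f.Nondegenerate) (hk : 1 < k)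
    (hV : 2 * k < Module.finrank K V) :
    imageLines (plueckerEmbedding f (zero_lt_one.trans hk)) (grassLines f k) =
      branchedLines (projLines K (imageSpan (plueckerMap f (zero_lt_one.trans hk))))
        (support (plueckerEmbedding f (zero_lt_one.trans hk))) := by
  ext S
  constructor
  · rintro ⟨l, hl, rfl⟩
    obtain ⟨Z, W, hp, hW, rfl⟩ := mem_grassLines_iff.1 hl
    exact (hp.image_mem_branchedLines_iff hf hnd hk hV).2 hW
  · intro hS
    obtain ⟨Z, W, hp, rfl⟩ := exists_isPencil_of_subset_support hf _ hS.1 hS.2.1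
    exact Set.mem_image_of_mem _ (mem_grassLines_iff.2
      ⟨Z, W, hp, (hp.image_mem_branchedLines_iff hf hnd hk hV).1 hS, rfl⟩)

end Embedding

end SymplecticGrassmann

theorem mainTheorem4 {K : Type*} [Field K] {V : Type*} [AddCommGroup V] [Module K V]
    (n k : ℕ) (hk : 1 < k) (hkn : k < n) (hV : Module.finrank K V = 2 * n)
    (f : LinearMap.BilinForm K V) (hf : f.IsAlt) (hnd : f.Nondegenerate) :
    SymplecticGrassmann.autSupport
        (SymplecticGrassmann.plueckerEmbedding f (zero_lt_one.trans hk)) =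
      SymplecticGrassmann.autEmbedding
        (SymplecticGrassmann.plueckerEmbedding f (zero_lt_one.trans hk))
        (SymplecticGrassmann.grassLines f k) ∧
    ¬ SymplecticGrassmann.IsTransparent
        (SymplecticGrassmann.plueckerEmbedding f (zero_lt_one.trans hk))
        (SymplecticGrassmann.grassLines f k) := by
  have : FiniteDimensional K V := Module.finite_of_finrank_pos (by omega)
  have hlines := SymplecticGrassmann.imageLines_grassLines_eq hf hnd hk (by omega)
  constructor
  -- `autEmbedding` is an intersection with `autSupport`, so only one inclusion needs proof.
  · refine (inf_eq_left.2 fun g hg => ?_).symm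
    rw [MulAction.mem_stabilizer_iff, hlines]
    exact SymplecticGrassmann.smul_branchedLines (g := g) g.2 hg
  · intro ht
    obtain ⟨Z, W, hp, hW⟩ := SymplecticGrassmann.exists_isPencil_not_isotropic hf hnd (zero_lt_one.trans hk)
      (by omega)
    have h := ht _ (hp.image_mem_projLines hf _) (Set.image_subset_range _ _)
    rw [hlines] at h
    exact hW ((hp.image_mem_branchedLines_iff hf hnd hk (by omega)).1 h)
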